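/- For a Dirichlet character $\chi$ modulo $q$, the Laurent–Stieltjes constants $\gamma_k(\chi)$ ($k \ge 0$) are defined by the Laurent expansion of the Dirichlet $L$-function at $s=1$, $$L(s,\chi)=\frac{\gamma_{-1}(\chi)}{s-1}+\sum_{k=0}^{\infty}\frac{(-1)^k\gamma_k(\chi)}{k!}(s-1)^k ,$$ where $\gamma_{-1}(\chi)=\varphi(q)/q$ if $\chi$ is the principal character modulo $q$ and $\gamma_{-1}(\chi)=0$ otherwise. For $r\ge 0$ let $\mathcal{P}_r$ be the set of the first $r$ primes and put $\gamma_k(\mathcal{P}_r):=\gamma_k(\chi_0)$, where $\chi_0$ is the principal Dirichlet character modulo $q=\prod_{p\in\mathcal{P}_r}p$ (so $q=1$ for $r=0$). Then $$|\gamma_1(\mathcal{P}_{r+1})|>|\gamma_1(\mathcal{P}_r)|$$ for all but finitely many integers $r \ge 0$. -/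

import Mathlib

open scoped Nat

/-- The coefficient `γ₋₁(χ)` of `1 / (s - 1)` in the Laurent expansion of `L(s, χ)` about `s = 1`:
it is `φ(q) / q` for the principal character modulo `q`, and `0` for every other character. -/
noncomputable def laurentResidue {q : ℕ} (χ : DirichletCharacter ℂ q) : ℂ :=
  open Classical in if χ = 1 then (φ q : ℂ) / (q : ℂ) else 0

/-- `γ` is the sequence of Laurent–Stieltjes constants of `χ`, i.e.
`L(s, χ) = γ₋₁(χ) / (s - 1) + ∑ₖ (-1)ᵏ γₖ / k! · (s - 1)ᵏ` for all `s ≠ 1`,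
where `L(s, χ)` is the (meromorphically continued) Dirichlet `L`-function. -/
def IsLaurentStieltjes {q : ℕ} [NeZero q] (χ : DirichletCharacter ℂ q) (γ : ℕ → ℂ) : Prop :=
  ∀ s : ℂ, s ≠ 1 →
    HasSum (fun k : ℕ ↦ (-1) ^ k * γ k / (k ! : ℂ) * (s - 1) ^ k)
      (χ.LFunction s - laurentResidue χ / (s - 1))

/-- Every Dirichlet `L`-function has such an expansion. -/
theorem exists_isLaurentStieltjes {q : ℕ} [NeZero q] (χ : DirichletCharacter ℂ q) :
    ∃ γ : ℕ → ℂ, IsLaurentStieltjes χ γ := by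
  obtain ⟨h, hd, h1, hs⟩ : ∃ h : ℂ → ℂ, Differentiable ℂ h ∧ h 1 = laurentResidue χ ∧
      ∀ s, s ≠ 1 → h s = (s - 1) * χ.LFunction s := by
    by_cases hχ : χ = 1
    · subst hχ
      refine ⟨DirichletCharacter.LFunctionTrivChar₁ q,
        DirichletCharacter.differentiable_LFunctionTrivChar₁ q, ?_, fun s hs ↦ ?_⟩
      · have hq : (q : ℂ) ≠ 0 := by exact_mod_cast NeZero.ne q
        have := congrArg (fun x : ℚ ↦ (x : ℂ)) (Nat.totient_eq_mul_prod_factors q)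
        push_cast at this
        simp [DirichletCharacter.LFunctionTrivChar₁, laurentResidue, this, hq]
      · simp [DirichletCharacter.LFunctionTrivChar₁, DirichletCharacter.LFunctionTrivChar, hs]
    · refine ⟨fun s ↦ (s - 1) * χ.LFunction s, ?_, by simp [laurentResidue, hχ], fun s _ ↦ rfl⟩
      have := DirichletCharacter.differentiable_LFunction hχ
      fun_prop
  refine ⟨fun k ↦ (-1) ^ k * iteratedDeriv (k + 1) h 1 / (k + 1), fun s hs1 ↦ ?_⟩
  have hne : s - 1 ≠ 0 := sub_ne_zero.mpr hs1
  have H := (hasSum_nat_add_iff' 1).mpr (Complex.hasSum_taylorSeries_of_entire hd 1 s)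
  have hval : (s - 1)⁻¹ * (h s - ∑ i ∈ Finset.range 1,
      ((i ! : ℂ))⁻¹ • (s - 1) ^ i • iteratedDeriv i h 1) =
      χ.LFunction s - laurentResidue χ / (s - 1) := by
    simp [h1, hs s hs1]
    field_simp
  rw [← hval]
  refine Eq.mp (congrArg (HasSum · _) (funext fun k ↦ ?_)) (H.mul_left (s - 1)⁻¹)
  symm
  have hk : (k ! : ℂ) ≠ 0 := by exact_mod_cast k.factorial_ne_zero
  have hk1 : (k + 1 : ℂ) ≠ 0 := by exact_mod_cast k.succ_ne_zero
  have hsq : ((-1 : ℂ) ^ k) ^ 2 = 1 := by rw [← pow_mul, mul_comm, pow_mul]; simp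
  simp only [Nat.factorial_succ, smul_eq_mul, pow_succ (s - 1)]
  push_cast
  field_simp
  simp [hsq]

/-- The expansion determines its coefficients. -/
theorem IsLaurentStieltjes.unique {q : ℕ} [NeZero q] {χ : DirichletCharacter ℂ q}
    {γ γ' : ℕ → ℂ} (h : IsLaurentStieltjes χ γ) (h' : IsLaurentStieltjes χ γ') : γ = γ' := by
  set d : ℕ → ℂ := fun k ↦ (-1) ^ k * (γ k - γ' k) / (k ! : ℂ) with hd
  have hsum : ∀ z : ℂ, z ≠ 0 → HasSum (fun k ↦ d k * z ^ k) 0 := fun z hz ↦ by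
    have := (h (z + 1) (by simpa using hz)).sub (h' (z + 1) (by simpa using hz))
    simp only [add_sub_cancel_right, sub_self] at this
    refine Eq.mp (congrArg (HasSum · _) (funext fun k ↦ ?_)) this
    symm
    simp only [d]
    ring
  have key : ∀ n, d n = 0 := by
    intro n
    induction n using Nat.strong_induction_on with
    | _ n ih =>
      -- divide the vanishing series by `z ^ n` and let `z` tend to `0`
      have hz : ∀ z : ℂ, z ≠ 0 → HasSum (fun k ↦ d (k + n) * z ^ k) 0 := fun z hz ↦ by
        have := ((hasSum_nat_add_iff' n).mpr (hsum z hz)).mul_left (z ^ n)⁻¹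
        rw [Finset.sum_eq_zero (fun i hi ↦ by simp [ih i (Finset.mem_range.mp hi)])] at this
        simp only [sub_zero, mul_zero] at this
        refine Eq.mp (congrArg (HasSum · _) (funext fun k ↦ ?_)) this
        symm
        rw [pow_add]
        field_simp
      have hsm : Summable fun k ↦ ‖d (k + n)‖ := by
        simpa using (hz 1 one_ne_zero).summable.norm
      have hc : ContinuousOn (fun z : ℂ ↦ ∑' k, d (k + n) * z ^ k) (Metric.closedBall 0 1) := by
        refine continuousOn_tsum (fun k ↦ by fun_prop) hsm fun k z hz ↦ ?_
        rw [norm_mul, norm_pow]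
        have : ‖z‖ ≤ 1 := by simpa using hz
        exact mul_le_of_le_one_right (norm_nonneg _) (pow_le_one₀ (norm_nonneg _) this)
      have hc0 := (hc.continuousAt (Metric.closedBall_mem_nhds 0 one_pos)).tendsto
      have hv : ∑' k, d (k + n) * (0 : ℂ) ^ k = d n := by
        rw [tsum_eq_single 0 (fun k hk ↦ by simp [hk])]
        simp
      rw [hv] at hc0
      refine tendsto_nhds_unique (hc0.mono_left (nhdsWithin_le_nhds (s := {0}ᶜ))) ?_
      refine tendsto_const_nhds.congr' ?_
      filter_upwards [self_mem_nhdsWithin] with z hz0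
      exact (hz z hz0).tsum_eq.symm
  funext k
  have hk := key k
  simpa [hd, sub_eq_zero, Nat.factorial_ne_zero] using hk

/-- The `k`-th Laurent–Stieltjes constant `γₖ(χ)`. -/
noncomputable def laurentStieltjes {q : ℕ} [NeZero q] (χ : DirichletCharacter ℂ q) (k : ℕ) : ℂ :=
  (exists_isLaurentStieltjes χ).choose k

/-- The product of the first `r` primes (`1` for `r = 0`). -/
noncomputable def primeProd (r : ℕ) : ℕ :=
  ∏ i ∈ Finset.range r, Nat.nth Nat.Prime i

instance primeProd_neZero (r : ℕ) : NeZero (primeProd r) :=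
  ⟨Finset.prod_ne_zero_iff.mpr fun i _ ↦ (Nat.prime_nth_prime i).ne_zero⟩

/-- `γₖ(𝒫ᵣ)`: the `k`-th Laurent–Stieltjes constant of the principal character modulo the product
of the first `r` primes. -/
noncomputable def gammaP (k r : ℕ) : ℂ :=
  laurentStieltjes (1 : DirichletCharacter ℂ (primeProd r)) k

/-! Up to the factor `-1/2`, `γ₁(𝒫ᵣ)` is `h''(1)` for the entire function `h(s) = (s - 1) ζ(s) ∏ (1
- p⁻ˢ)` over the first `r` primes. Logarithmic differentiation gives `h''(1) = A (D² - U + c')`,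
where `A = ∏ (1 - 1/p)`, `D = γ + ∑ log p / (p - 1)`, `U = ∑ p log² p / (p - 1)²` and `c'` is a real
constant (`entirePartialZeta_jet`). For the next prime `p`, with `w = log p`, `h''(1)` changes by
exactly `(A / p) (w (2D - w) - (D² - U + c'))`. Mertens' first theorem gives `D = w + O(1)`, so `w
(2D - w)` is about `w²`. Truly `U` is about `w²/2`, but any bounds `w²/4` and `3w²/4` up to `O(w)`
suffice (`exists_sum_mul_log_sq_div_bounds`): they make `D² - U + c'` positive and smaller than `w
(2D - w)` once `p` is large. -/

/-! ### `γ₁` as a second derivative at `1`. -/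

theorem deriv_deriv_mul {f g : ℂ → ℂ} (hf : Differentiable ℂ f) (hg : Differentiable ℂ g) (s : ℂ) :
    deriv (deriv (fun z ↦ f z * g z)) s =
      deriv (deriv f) s * g s + 2 * (deriv f s * deriv g s) + f s * deriv (deriv g) s := by
  have h : deriv (fun z ↦ f z * g z) = fun z ↦ deriv f z * g z + f z * deriv g z :=
    funext fun z ↦ deriv_fun_mul (hf z) (hg z)
  have hf' : Differentiable ℂ (deriv f) := hf.deriv
  have hg' : Differentiable ℂ (deriv g) := hg.deriv
  rw [h, deriv_fun_add ((hf' s).fun_mul (hg s)) ((hf s).fun_mul (hg' s)),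
    deriv_fun_mul (hf' s) (hg s), deriv_fun_mul (hf s) (hg' s)]
  ring

/-- The Laurent–Stieltjes constants are the Taylor coefficients at `1` of an entire function
agreeing with `(s - 1) L(s, χ)`. -/
theorem isLaurentStieltjes_of_entire {q : ℕ} [NeZero q] {χ : DirichletCharacter ℂ q} {h : ℂ → ℂ}
    (hd : Differentiable ℂ h) (h1 : h 1 = laurentResidue χ)
    (hs : ∀ s, s ≠ 1 → h s = (s - 1) * χ.LFunction s) :
    IsLaurentStieltjes χ (fun k ↦ (-1) ^ k * iteratedDeriv (k + 1) h 1 / (k + 1)) := by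
  intro s hs1
  have hne : s - 1 ≠ 0 := sub_ne_zero.mpr hs1
  have H := (hasSum_nat_add_iff' 1).mpr (Complex.hasSum_taylorSeries_of_entire hd 1 s)
  have hval : (s - 1)⁻¹ * (h s - ∑ i ∈ Finset.range 1,
      ((i ! : ℂ))⁻¹ • (s - 1) ^ i • iteratedDeriv i h 1) =
      χ.LFunction s - laurentResidue χ / (s - 1) := by
    simp [h1, hs s hs1]
    field_simp
  rw [← hval]
  refine Eq.mp (congrArg (HasSum · _) (funext fun k ↦ ?_)) (H.mul_left (s - 1)⁻¹)
  symm
  have hk : (k ! : ℂ) ≠ 0 := by exact_mod_cast k.factorial_ne_zero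
  have hk1 : (k + 1 : ℂ) ≠ 0 := by exact_mod_cast k.succ_ne_zero
  have hsq : ((-1 : ℂ) ^ k) ^ 2 = 1 := by rw [← pow_mul, mul_comm, pow_mul]; simp
  simp only [Nat.factorial_succ, smul_eq_mul, pow_succ (s - 1)]
  push_cast
  field_simp
  simp [hsq]

/-- The entire function `(s - 1) ζ(s) ∏_{i < r} (1 - pᵢ⁻ˢ)`. -/
noncomputable def entirePartialZeta : ℕ → ℂ → ℂ
  | 0 => riemannZeta₁
  | r + 1 => fun s ↦ entirePartialZeta r s * (1 - (Nat.nth Nat.Prime r : ℂ) ^ (-s))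

theorem differentiable_one_sub_cpow_neg {p : ℕ} (hp : p ≠ 0) :
    Differentiable ℂ fun s : ℂ ↦ 1 - (p : ℂ) ^ (-s) := by
  have hp' : (p : ℂ) ≠ 0 := by exact_mod_cast hp
  intro s
  exact (differentiableAt_const _).sub (differentiableAt_id.neg.const_cpow (Or.inl hp'))

theorem differentiable_entirePartialZeta (r : ℕ) : Differentiable ℂ (entirePartialZeta r) := by
  induction r with
  | zero => exact differentiable_riemannZeta₁
  | succ r ih =>
    exact ih.mul (differentiable_one_sub_cpow_neg (Nat.prime_nth_prime r).ne_zero)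

theorem entirePartialZeta_eq (r : ℕ) (s : ℂ) :
    entirePartialZeta r s =
      riemannZeta₁ s * ∏ i ∈ Finset.range r, (1 - (Nat.nth Nat.Prime i : ℂ) ^ (-s)) := by
  induction r with
  | zero => simp [entirePartialZeta]
  | succ r ih => rw [Finset.prod_range_succ, ← mul_assoc, ← ih, entirePartialZeta]

theorem primeFactors_primeProd (r : ℕ) :
    (primeProd r).primeFactors = (Finset.range r).image (Nat.nth Nat.Prime) := by
  rw [primeProd, ← Finset.prod_image (f := fun p : ℕ ↦ p)
    ((Nat.nth_injective Nat.infinite_setOfPred_prime).injOn)]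
  refine Nat.primeFactors_prod fun p hp ↦ ?_
  obtain ⟨i, -, rfl⟩ := Finset.mem_image.mp hp
  exact Nat.prime_nth_prime i

theorem prod_primeFactors_primeProd (r : ℕ) (f : ℕ → ℂ) :
    ∏ p ∈ (primeProd r).primeFactors, f p = ∏ i ∈ Finset.range r, f (Nat.nth Nat.Prime i) := by
  rw [primeFactors_primeProd,
    Finset.prod_image ((Nat.nth_injective Nat.infinite_setOfPred_prime).injOn)]

theorem gammaP_one_eq (r : ℕ) :
    gammaP 1 r = -(deriv (deriv (entirePartialZeta r)) 1 / 2) := by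
  have H := isLaurentStieltjes_of_entire (χ := (1 : DirichletCharacter ℂ (primeProd r)))
    (differentiable_entirePartialZeta r) ?_ ?_
  · rw [gammaP, laurentStieltjes,
      IsLaurentStieltjes.unique (exists_isLaurentStieltjes _).choose_spec H]
    norm_num [iteratedDeriv_succ]
    ring
  · have hq : (primeProd r : ℂ) ≠ 0 := by exact_mod_cast NeZero.ne (primeProd r)
    have := congrArg (fun x : ℚ ↦ (x : ℂ)) (Nat.totient_eq_mul_prod_factors (primeProd r))
    push_cast at this
    rw [laurentResidue, if_pos rfl, this, mul_div_cancel_left₀ _ hq,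
      prod_primeFactors_primeProd r (fun p ↦ 1 - (p : ℂ)⁻¹), entirePartialZeta_eq]
    simp [Complex.cpow_neg_one]
  · intro s hs
    have := DirichletCharacter.LFunctionTrivChar_eq_mul_riemannZeta (N := primeProd r) hs
    rw [DirichletCharacter.LFunctionTrivChar] at this
    rw [this, prod_primeFactors_primeProd r (fun p ↦ 1 - (p : ℂ) ^ (-s)), entirePartialZeta_eq,
      riemannZeta_eq_inv_sub_mul hs]
    have : s - 1 ≠ 0 := sub_ne_zero.mpr hs
    field_simp

/-! ### Reality and the second-order jet at `1`. -/

theorem riemannZeta₁_conj (s : ℂ) :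
    riemannZeta₁ ((starRingEnd ℂ) s) = (starRingEnd ℂ) (riemannZeta₁ s) := by
  rcases eq_or_ne s 1 with rfl | hs
  · simp
  · have hs' : (starRingEnd ℂ) s ≠ 1 := fun h ↦ hs (by simpa using congrArg (starRingEnd ℂ) h)
    simp [riemannZeta₁, riemannZeta₀, hs, hs', riemannZeta_conj]

/-- Commuting with conjugation passes to derivatives. Only reality is needed, to compare signs; the
value is irrelevant for large `r`. -/
theorem exists_deriv_deriv_riemannZeta₁_eq_ofReal :
    ∃ c : ℝ, deriv (deriv riemannZeta₁) 1 = c := by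
  have h0 : (starRingEnd ℂ) ∘ riemannZeta₁ ∘ (starRingEnd ℂ) = riemannZeta₁ :=
    funext fun s ↦ by simp [riemannZeta₁_conj]
  have h1 : (starRingEnd ℂ) ∘ deriv riemannZeta₁ ∘ (starRingEnd ℂ) = deriv riemannZeta₁ := by
    rw [← deriv_conj_conj, h0]
  have h2 : (starRingEnd ℂ) ∘ deriv (deriv riemannZeta₁) ∘ (starRingEnd ℂ) =
      deriv (deriv riemannZeta₁) := by
    rw [← deriv_conj_conj, h1]
  have := congrFun h2 1
  simp only [Function.comp_apply, map_one] at this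
  exact ⟨_, (Complex.conj_eq_iff_re.mp this).symm⟩

theorem hasDerivAt_natCast_cpow_neg {p : ℕ} (hp : p ≠ 0) (s : ℂ) :
    HasDerivAt (fun s : ℂ ↦ (p : ℂ) ^ (-s)) (-(Real.log p : ℂ) * (p : ℂ) ^ (-s)) s := by
  have hp' : (p : ℂ) ≠ 0 := by exact_mod_cast hp
  convert! (hasDerivAt_id s).neg.const_cpow (c := (p : ℂ)) (Or.inl hp') using 1
  rw [Complex.natCast_log]
  simp
  ring

theorem deriv_one_sub_cpow_neg {p : ℕ} (hp : p ≠ 0) :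
    deriv (fun s : ℂ ↦ 1 - (p : ℂ) ^ (-s)) = fun s ↦ (Real.log p : ℂ) * (p : ℂ) ^ (-s) := by
  funext s
  rw [((hasDerivAt_natCast_cpow_neg hp s).const_sub 1).deriv]
  ring

theorem deriv_deriv_one_sub_cpow_neg {p : ℕ} (hp : p ≠ 0) (s : ℂ) :
    deriv (deriv fun s : ℂ ↦ 1 - (p : ℂ) ^ (-s)) s =
      -(Real.log p : ℂ) ^ 2 * (p : ℂ) ^ (-s) := by
  rw [deriv_one_sub_cpow_neg hp, ((hasDerivAt_natCast_cpow_neg hp s).const_mul _).deriv]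
  ring

/-- Values at `1` of `entirePartialZeta r` and its first two derivatives. -/
theorem entirePartialZeta_jet {c : ℝ} (hc : deriv (deriv riemannZeta₁) 1 = c) (r : ℕ) {A D U : ℝ}
    (hA : A = ∏ i ∈ Finset.range r, (1 - 1 / (Nat.nth Nat.Prime i : ℝ)))
    (hD : D = Real.eulerMascheroniConstant + ∑ i ∈ Finset.range r,
      Real.log (Nat.nth Nat.Prime i) / ((Nat.nth Nat.Prime i : ℝ) - 1))
    (hU : U = ∑ i ∈ Finset.range r, (Nat.nth Nat.Prime i : ℝ) *
      Real.log (Nat.nth Nat.Prime i) ^ 2 / ((Nat.nth Nat.Prime i : ℝ) - 1) ^ 2) :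
    entirePartialZeta r 1 = A ∧ deriv (entirePartialZeta r) 1 = (A * D : ℝ) ∧
      deriv (deriv (entirePartialZeta r)) 1 =
        (A * (D ^ 2 - U + (c - Real.eulerMascheroniConstant ^ 2)) : ℝ) := by
  induction r generalizing A D U with
  | zero =>
    subst hA hD hU
    -- Here `D` is Euler's constant, the derivative of `riemannZeta₁` at `1`; subtracting its square
    -- leaves `c`.
    simp [entirePartialZeta, hc]
  | succ r ih =>
    obtain ⟨h0, h1, h2⟩ := ih rfl rfl rfl
    rw [Finset.prod_range_succ] at hA
    rw [Finset.sum_range_succ, ← add_assoc] at hD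
    rw [Finset.sum_range_succ] at hU
    set p := Nat.nth Nat.Prime r with hp
    have hpp : p.Prime := Nat.prime_nth_prime r
    have hp1 : ((p : ℂ) - 1) ≠ 0 := sub_ne_zero.mpr (by exact_mod_cast hpp.ne_one)
    have hp0 : (p : ℂ) ≠ 0 := by exact_mod_cast hpp.ne_zero
    have hd := differentiable_entirePartialZeta r
    have hg := differentiable_one_sub_cpow_neg hpp.ne_zero
    have hE : entirePartialZeta (r + 1) = fun s ↦ entirePartialZeta r s * (1 - (p : ℂ) ^ (-s)) :=
      rfl
    refine ⟨?_, ?_, ?_⟩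
    · rw [hE, hA]
      simp only [h0, Complex.cpow_neg_one]
      push_cast
      ring
    · rw [hE, deriv_fun_mul (hd 1) (hg 1), h0, h1, deriv_one_sub_cpow_neg hpp.ne_zero, hA, hD]
      simp only [Complex.cpow_neg_one]
      push_cast
      field_simp
    -- With `w = log p`, the factor contributes `2Dw/(p - 1) - w²/(p - 1)` inside the bracket.
    -- Completing the square in `D` adds `w²/(p - 1)²`, so `U` must grow by `p w²/(p - 1)²`.
    · rw [hE, deriv_deriv_mul hd hg, h0, h1, h2, deriv_deriv_one_sub_cpow_neg hpp.ne_zero,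
        deriv_one_sub_cpow_neg hpp.ne_zero, hA, hD, hU]
      simp only [Complex.cpow_neg_one]
      push_cast
      field_simp
      ring

/-! ### Mertens' first theorem. -/

theorem Real.log_factorial_eq_sum_primesLE (n : ℕ) :
    Real.log (n ! : ℕ) = ∑ p ∈ n.primesLE, ((n !).factorization p : ℝ) * Real.log p := by
  rw [Real.log_nat_eq_sum_factorization]
  refine Finsupp.sum_of_support_subset _ (fun p hp ↦ ?_) _ (by simp)
  rw [Nat.support_factorization, Nat.mem_primeFactors] at hp
  exact Nat.mem_primesLE.mpr ⟨(hp.1.dvd_factorial).mp hp.2.1, hp.1⟩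

theorem Nat.div_le_factorization_factorial {p : ℕ} (hp : p.Prime) (n : ℕ) :
    n / p ≤ (n !).factorization p := by
  rw [Nat.factorization_factorial hp (Nat.lt_add_of_pos_right two_pos)]
  have h1 : 1 ∈ Finset.Ico 1 (Nat.log p n + 2) := by simp
  simpa using Finset.single_le_sum (f := fun i ↦ n / p ^ i) (fun i _ ↦ Nat.zero_le _) h1

/-- The lower half of Mertens' first theorem. -/
theorem log_sub_one_le_sum_log_div_sub_one {n : ℕ} (hn : n ≠ 0) :
    Real.log n - 1 ≤ ∑ p ∈ n.primesLE, Real.log p / ((p : ℝ) - 1) := by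
  have hn0 : (0 : ℝ) < n := by exact_mod_cast Nat.pos_of_ne_zero hn
  have h1 : (n : ℝ) * Real.log n - n ≤ Real.log (n ! : ℕ) := by
    have h := Stirling.le_log_factorial_stirling hn
    have h2 : 0 ≤ Real.log n := Real.log_natCast_nonneg n
    have h3 : 0 ≤ Real.log (2 * Real.pi) :=
      Real.log_nonneg (by linarith [Real.pi_gt_three])
    linarith
  have h2 : Real.log (n ! : ℕ) ≤ n * ∑ p ∈ n.primesLE, Real.log p / ((p : ℝ) - 1) := by
    rw [Real.log_factorial_eq_sum_primesLE, Finset.mul_sum]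
    refine Finset.sum_le_sum fun p hp ↦ ?_
    have hpp := Nat.prime_of_mem_primesLE hp
    -- Legendre's formula summed as a full geometric series, hence the weight `1/(p - 1)`.
    have hv : ((n !).factorization p : ℝ) ≤ n / ((p : ℝ) - 1) := by
      refine (Nat.cast_le.mpr (Nat.factorization_factorial_le_div_pred hpp n)).trans ?_
      refine Nat.cast_div_le.trans_eq ?_
      rw [Nat.cast_sub hpp.one_le, Nat.cast_one]
    calc _ ≤ (n / ((p : ℝ) - 1)) * Real.log p :=
          mul_le_mul_of_nonneg_right hv (Real.log_natCast_nonneg p)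
      _ = _ := by ring
  have h3 : (n : ℝ) * (Real.log n - 1) ≤ n * ∑ p ∈ n.primesLE, Real.log p / ((p : ℝ) - 1) := by
    linarith
  exact le_of_mul_le_mul_left h3 hn0

/-- The upper half of Mertens' first theorem. -/
theorem sum_log_div_le_log_add {n : ℕ} (hn : n ≠ 0) :
    ∑ p ∈ n.primesLE, Real.log p / (p : ℝ) ≤ Real.log n + Real.log 4 := by
  have hn0 : (0 : ℝ) < n := by exact_mod_cast Nat.pos_of_ne_zero hn
  have h1 : Real.log (n ! : ℕ) ≤ n * Real.log n := by
    rw [← Real.log_pow]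
    exact Real.log_le_log (by exact_mod_cast n.factorial_pos) (by exact_mod_cast n.factorial_le_pow)
  have h2 : n * (∑ p ∈ n.primesLE, Real.log p / (p : ℝ)) - ∑ p ∈ n.primesLE, Real.log p ≤
      Real.log (n ! : ℕ) := by
    rw [Real.log_factorial_eq_sum_primesLE, Finset.mul_sum, ← Finset.sum_sub_distrib]
    refine Finset.sum_le_sum fun p hp ↦ ?_
    have hpp := Nat.prime_of_mem_primesLE hp
    -- Rounding costs at most `log p` per prime, in total `θ(n) ≤ n log 4` by Chebyshev.
    have hv : (n : ℝ) / p - 1 ≤ ((n !).factorization p : ℝ) := by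
      have := Nat.lt_div_mul_add (a := n) hpp.pos
      have h3 : (n : ℝ) ≤ ((n / p : ℕ) + 1) * p := by
        norm_cast
        nlinarith
      have h4 : (n : ℝ) / p ≤ (n / p : ℕ) + 1 :=
        (div_le_iff₀ (by exact_mod_cast hpp.pos)).mpr h3
      have h5 : ((n / p : ℕ) : ℝ) ≤ (n !).factorization p :=
        Nat.cast_le.mpr (Nat.div_le_factorization_factorial hpp n)
      linarith
    calc _ = ((n : ℝ) / p - 1) * Real.log p := by ring
      _ ≤ _ := mul_le_mul_of_nonneg_right hv (Real.log_natCast_nonneg p)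
  have h3 : ∑ p ∈ n.primesLE, Real.log p ≤ Real.log 4 * n := by
    rw [← Chebyshev.theta_eq_sum_primesLE_log]
    exact Chebyshev.theta_le_log4_mul_x hn0.le
  refine le_of_mul_le_mul_left (a := (n : ℝ)) ?_ hn0
  linarith

theorem exists_sum_le_of_le_rpow {f : ℕ → ℝ} {C : ℝ} (hC : 0 ≤ C)
    (hf : ∀ p : ℕ, p.Prime → f p ≤ C * (p : ℝ) ^ (-(3 / 2) : ℝ)) :
    ∃ K, ∀ n : ℕ, ∑ p ∈ n.primesLE, f p ≤ K := by
  have hs : Summable fun n : ℕ ↦ C * (n : ℝ) ^ (-(3 / 2) : ℝ) :=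
    (Real.summable_nat_rpow.mpr (by norm_num)).mul_left C
  refine ⟨_, fun n ↦ (Finset.sum_le_sum fun p hp ↦ hf p (Nat.prime_of_mem_primesLE hp)).trans
    (hs.sum_le_tsum _ fun i _ ↦ by positivity)⟩

theorem Real.log_natCast_sq_le (p : ℕ) : Real.log p ^ 2 ≤ 16 * (p : ℝ) ^ (1 / 2 : ℝ) := by
  have h := Real.log_le_rpow_div (Nat.cast_nonneg p) (by norm_num : (0 : ℝ) < 1 / 4)
  have h2 := pow_le_pow_left₀ (Real.log_natCast_nonneg p) h 2
  refine h2.trans_eq ?_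
  rw [div_pow, ← Real.rpow_natCast, ← Real.rpow_mul (Nat.cast_nonneg p)]
  norm_num
  ring

theorem log_sq_div_sub_one_sq_le {p : ℕ} (hp : p.Prime) :
    Real.log p ^ 2 / ((p : ℝ) - 1) ^ 2 ≤ 64 * (p : ℝ) ^ (-(3 / 2) : ℝ) := by
  have hp2 : (2 : ℝ) ≤ p := by exact_mod_cast hp.two_le
  have hp0 : (0 : ℝ) < p := by linarith
  have hx : (p : ℝ) ^ (1 / 2 : ℝ) = (p : ℝ) ^ (-(3 / 2) : ℝ) * (p : ℝ) ^ 2 := by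
    rw [← Real.rpow_natCast, ← Real.rpow_add hp0]
    norm_num
  have h := Real.log_natCast_sq_le p
  rw [hx] at h
  rw [div_le_iff₀ (by nlinarith)]
  have h4 : (p : ℝ) ^ 2 ≤ 4 * ((p : ℝ) - 1) ^ 2 := by nlinarith
  have h5 : 0 ≤ (p : ℝ) ^ (-(3 / 2) : ℝ) := by positivity
  nlinarith [mul_le_mul_of_nonneg_left h4 h5]

theorem log_div_mul_sub_one_le {p : ℕ} (hp : p.Prime) :
    Real.log p / (p * ((p : ℝ) - 1)) ≤ 4 * (p : ℝ) ^ (-(3 / 2) : ℝ) := by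
  have hp2 : (2 : ℝ) ≤ p := by exact_mod_cast hp.two_le
  have hp0 : (0 : ℝ) < p := by linarith
  have hx : (p : ℝ) ^ (1 / 2 : ℝ) = (p : ℝ) ^ (-(3 / 2) : ℝ) * (p : ℝ) ^ 2 := by
    rw [← Real.rpow_natCast, ← Real.rpow_add hp0]
    norm_num
  have h := Real.log_le_rpow_div hp0.le (by norm_num : (0 : ℝ) < 1 / 2)
  rw [hx] at h
  rw [div_le_iff₀ (by nlinarith)]
  have h4 : (p : ℝ) ^ 2 ≤ 2 * (p * ((p : ℝ) - 1)) := by nlinarith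
  have h5 : 0 ≤ (p : ℝ) ^ (-(3 / 2) : ℝ) := by positivity
  nlinarith [mul_le_mul_of_nonneg_left h4 h5]

/-- Mertens' first theorem, with weights `log p / (p - 1)`. -/
theorem exists_abs_sum_log_div_sub_one_sub_log_le :
    ∃ K, ∀ n : ℕ, n ≠ 0 →
      |∑ p ∈ n.primesLE, Real.log p / ((p : ℝ) - 1) - Real.log n| ≤ K := by
  obtain ⟨K, hK⟩ := exists_sum_le_of_le_rpow (by norm_num) fun p hp ↦ log_div_mul_sub_one_le hp
  refine ⟨max 1 (K + Real.log 4), fun n hn ↦ abs_le.mpr ⟨?_, ?_⟩⟩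
  · linarith [log_sub_one_le_sum_log_div_sub_one hn, le_max_left 1 (K + Real.log 4)]
  · have h : ∑ p ∈ n.primesLE, Real.log p / ((p : ℝ) - 1) =
        ∑ p ∈ n.primesLE, Real.log p / (p : ℝ) +
          ∑ p ∈ n.primesLE, Real.log p / (p * ((p : ℝ) - 1)) := by
      rw [← Finset.sum_add_distrib]
      refine Finset.sum_congr rfl fun p hp ↦ ?_
      have hp2 : (2 : ℝ) ≤ p := by exact_mod_cast Nat.two_le_of_mem_primesLE hp
      have h1 : (p : ℝ) ≠ 0 := by linarith
      have h2 : (p : ℝ) - 1 ≠ 0 := by linarith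
      field_simp
      ring
    linarith [sum_log_div_le_log_add hn, hK n, le_max_right 1 (K + Real.log 4)]

/-! ### Bounds for the sum `U`. -/

/-- `∑_{p ≤ n} p log² p / (p - 1)²` lies between `log² n / 4` and `3 log² n / 4`,
up to `O(log n)`. -/
theorem exists_sum_mul_log_sq_div_bounds :
    ∃ K, 0 ≤ K ∧ ∀ n : ℕ, n ≠ 0 →
      |∑ p ∈ n.primesLE, Real.log p / ((p : ℝ) - 1) - Real.log n| ≤ K ∧
      Real.log n ^ 2 / 4 - K * Real.log n ≤
        ∑ p ∈ n.primesLE, p * Real.log p ^ 2 / ((p : ℝ) - 1) ^ 2 ∧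
      ∑ p ∈ n.primesLE, p * Real.log p ^ 2 / ((p : ℝ) - 1) ^ 2 ≤
        3 / 4 * Real.log n ^ 2 + K * Real.log n + K := by
  obtain ⟨K, hK⟩ := exists_abs_sum_log_div_sub_one_sub_log_le
  obtain ⟨B, hB⟩ := exists_sum_le_of_le_rpow (by norm_num) fun p hp ↦ log_sq_div_sub_one_sq_le hp
  have hK0 : 0 ≤ K := (abs_nonneg _).trans (hK 1 one_ne_zero)
  refine ⟨max (2 * K + 1) B, le_max_of_le_left (by linarith), fun n hn ↦ ?_⟩
  set M := max (2 * K + 1) B with hM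
  have hM1 : 2 * K + 1 ≤ M := le_max_left _ _
  have hM2 : B ≤ M := le_max_right _ _
  set t : ℕ → ℝ := fun p ↦ Real.log p / ((p : ℝ) - 1) with ht
  set u : ℕ → ℝ := fun p ↦ p * Real.log p ^ 2 / ((p : ℝ) - 1) ^ 2 with hu
  set l := Real.log n with hl
  have hl0 : 0 ≤ l := Real.log_natCast_nonneg n
  -- Cutting at `√n` replaces partial summation: `log p` lies in `[l/2, l]` above the cut and is at
  -- most `l/2` below it, and each range carries `l/2 + O(1)` of the sum of `t`.
  set m := Nat.sqrt n with hm
  have hm0 : m ≠ 0 := (Nat.sqrt_pos.mpr (Nat.pos_of_ne_zero hn)).ne'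
  have hmn : m ≤ n := Nat.sqrt_le_self n
  have hmu : Real.log m ≤ l / 2 := by
    have h : Real.log ((m : ℝ) ^ 2) ≤ l :=
      Real.log_le_log (by positivity) (by exact_mod_cast Nat.sqrt_le' n)
    rw [Real.log_pow] at h
    push_cast at h
    linarith
  have hml : l / 2 - 1 ≤ Real.log m := by
    have h : l ≤ Real.log ((2 * m : ℝ) ^ 2) := by
      refine Real.log_le_log (by exact_mod_cast Nat.pos_of_ne_zero hn) ?_
      have h1 := Nat.lt_succ_sqrt' n
      have h2 : 1 ≤ m := Nat.one_le_iff_ne_zero.mpr hm0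
      rw [Nat.succ_eq_add_one, ← hm] at h1
      norm_cast
      nlinarith
    rw [Real.log_pow, Real.log_mul two_ne_zero (by exact_mod_cast hm0)] at h
    push_cast at h
    linarith [Real.log_two_lt_d9]
  have htn : ∀ p ∈ n.primesLE, 0 ≤ t p := fun p hp ↦ by
    have hp2 : (2 : ℝ) ≤ p := by exact_mod_cast Nat.two_le_of_mem_primesLE hp
    exact div_nonneg (Real.log_natCast_nonneg p) (by linarith)
  have hu_eq : ∀ p ∈ n.primesLE,
      u p = Real.log p * t p + Real.log p ^ 2 / ((p : ℝ) - 1) ^ 2 := fun p hp ↦ by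
    have hp2 : (2 : ℝ) ≤ p := by exact_mod_cast Nat.two_le_of_mem_primesLE hp
    have h2 : (p : ℝ) - 1 ≠ 0 := by linarith
    simp only [hu, ht]
    field_simp
    ring
  have hsub : m.primesLE ⊆ n.primesLE := Nat.primesLE_mono hmn
  set R := n.primesLE \ m.primesLE with hR
  have hsplit : ∀ f : ℕ → ℝ,
      ∑ p ∈ n.primesLE, f p = ∑ p ∈ R, f p + ∑ p ∈ m.primesLE, f p :=
    fun f ↦ (Finset.sum_sdiff hsub).symm
  have hRn : ∀ p ∈ R, p ∈ n.primesLE := fun p hp ↦ (Finset.mem_sdiff.mp hp).1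
  have hRl : ∀ p ∈ R, l / 2 ≤ Real.log p := fun p hp ↦ by
    have hpn := Nat.mem_primesLE.mp (hRn p hp)
    have hmp : m < p := by
      by_contra! h
      exact (Finset.mem_sdiff.mp hp).2 (Nat.mem_primesLE.mpr ⟨h, hpn.2⟩)
    have h : l ≤ Real.log ((p : ℝ) ^ 2) :=
      Real.log_le_log (by exact_mod_cast Nat.pos_of_ne_zero hn)
        (by exact_mod_cast (Nat.sqrt_lt'.mp hmp).le)
    rw [Real.log_pow] at h
    push_cast at h
    linarith
  have hlog_le : ∀ k : ℕ, ∀ p ∈ k.primesLE, Real.log p ≤ Real.log k := fun k p hp ↦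
    Real.log_le_log (by exact_mod_cast (Nat.prime_of_mem_primesLE hp).pos)
      (by exact_mod_cast Nat.le_of_mem_primesLE hp)
  have hTn := abs_le.mp (hK n hn)
  have hTm := abs_le.mp (hK m hm0)
  have hT := hsplit t
  have hW := hsplit fun p ↦ Real.log p * t p
  have hU : ∑ p ∈ n.primesLE, u p = ∑ p ∈ n.primesLE, Real.log p * t p +
      ∑ p ∈ n.primesLE, Real.log p ^ 2 / ((p : ℝ) - 1) ^ 2 := by
    rw [← Finset.sum_add_distrib]
    exact Finset.sum_congr rfl hu_eq
  have hV0 : 0 ≤ ∑ p ∈ n.primesLE, Real.log p ^ 2 / ((p : ℝ) - 1) ^ 2 :=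
    Finset.sum_nonneg fun p _ ↦ by positivity
  have hW1 : l / 2 * ∑ p ∈ R, t p ≤ ∑ p ∈ R, Real.log p * t p := by
    rw [Finset.mul_sum]
    exact Finset.sum_le_sum fun p hp ↦ mul_le_mul_of_nonneg_right (hRl p hp) (htn p (hRn p hp))
  have hW2 : ∑ p ∈ R, Real.log p * t p ≤ l * ∑ p ∈ R, t p := by
    rw [Finset.mul_sum]
    exact Finset.sum_le_sum fun p hp ↦
      mul_le_mul_of_nonneg_right (hlog_le n p (hRn p hp)) (htn p (hRn p hp))
  have hW3 : 0 ≤ ∑ p ∈ m.primesLE, Real.log p * t p := Finset.sum_nonneg fun p hp ↦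
    mul_nonneg (Real.log_natCast_nonneg p) (htn p (hsub hp))
  have hW4 : ∑ p ∈ m.primesLE, Real.log p * t p ≤ l / 2 * ∑ p ∈ m.primesLE, t p := by
    rw [Finset.mul_sum]
    exact Finset.sum_le_sum fun p hp ↦
      mul_le_mul_of_nonneg_right ((hlog_le m p hp).trans hmu) (htn p (hsub hp))
  have hBn := hB n
  refine ⟨(hK n hn).trans (by linarith), ?_, ?_⟩
  · have h1 : l / 2 - 2 * K ≤ ∑ p ∈ R, t p := by linarith
    have h2 := mul_le_mul_of_nonneg_left h1 (div_nonneg hl0 zero_le_two)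
    nlinarith [mul_le_mul_of_nonneg_right hM1 hl0, mul_nonneg hK0 hl0]
  · have h1 : ∑ p ∈ n.primesLE, t p ≤ l + K := by linarith
    have h2 : l / 2 - 1 - K ≤ ∑ p ∈ m.primesLE, t p := by linarith
    have h3 := mul_le_mul_of_nonneg_left h1 hl0
    have h4 := mul_le_mul_of_nonneg_left h2 hl0
    -- Regrouped so that Mertens is used from above at `n` and from below at `m`: `l² - l²/4 =
    -- 3l²/4`.
    have h5 : ∑ p ∈ n.primesLE, Real.log p * t p ≤
        l * ∑ p ∈ n.primesLE, t p - l / 2 * ∑ p ∈ m.primesLE, t p := by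
      rw [hW, hT]
      linarith
    nlinarith [mul_le_mul_of_nonneg_right hM1 hl0, mul_nonneg hK0 hl0]

/-! ### Comparison of consecutive constants. -/

theorem sum_range_nth_prime (f : ℕ → ℝ) (r : ℕ) :
    ∑ i ∈ Finset.range r, f (Nat.nth Nat.Prime i) =
      ∑ p ∈ (Nat.nth Nat.Prime r - 1).primesLE, f p := by
  rw [← Nat.primesBelow_eq_primesLE_sub_one]
  induction r with
  | zero => simp [Nat.nth_prime_zero_eq_two]
  | succ r ih =>
    rw [Finset.sum_range_succ, ih, Nat.primesBelow, Nat.primesBelow,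
      Nat.filter_range_nth_eq_insert_of_infinite Nat.infinite_setOfPred_prime,
      Finset.sum_insert (by simp), add_comm]

/-- To leading order `D² - U` lies between `l²/4` and `3l²/4` while `w (2D - w)` is `l²`; the gaps
of `l²/4` absorb every `O(K l)` error because `l ≥ 100 K`. -/
theorem pos_and_lt_of_log_bounds {K l D U w c : ℝ} (hK : 1 ≤ K) (hl : 100 * K ≤ l)
    (hD : |D - l| ≤ K) (hU1 : l ^ 2 / 4 - K * l ≤ U) (hU2 : U ≤ 3 / 4 * l ^ 2 + K * l + K)
    (hw1 : l ≤ w) (hw2 : w ≤ l + 1) (hc : |c| ≤ K) :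
    0 < D ^ 2 - U + c ∧ D ^ 2 - U + c < w * (2 * D - w) := by
  obtain ⟨hD1, hD2⟩ := abs_le.mp hD
  obtain ⟨hc1, hc2⟩ := abs_le.mp hc
  have hl0 : 0 ≤ l := by linarith
  have hlK := mul_le_mul_of_nonneg_right hl hl0
  have hlK' := mul_le_mul_of_nonneg_right hl (by linarith : (0 : ℝ) ≤ K)
  have hKl := mul_le_mul_of_nonneg_right hK hl0
  have hlow : (l - K) ^ 2 ≤ D ^ 2 := pow_le_pow_left₀ (by linarith) (by linarith) 2
  have hupp : D ^ 2 ≤ (l + K) ^ 2 := pow_le_pow_left₀ (by linarith) (by linarith) 2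
  have hw : l * (l - 2 * K - 1) ≤ w * (2 * D - w) :=
    mul_le_mul hw1 (by linarith) (by linarith) (by linarith)
  constructor <;> nlinarith

theorem norm_gammaP_one_eq {c : ℝ} (hc : deriv (deriv riemannZeta₁) 1 = c) (r : ℕ) :
    ‖gammaP 1 r‖ = |(∏ i ∈ Finset.range r, (1 - 1 / (Nat.nth Nat.Prime i : ℝ))) *
      ((Real.eulerMascheroniConstant + ∑ i ∈ Finset.range r,
        Real.log (Nat.nth Nat.Prime i) / ((Nat.nth Nat.Prime i : ℝ) - 1)) ^ 2 -
      ∑ i ∈ Finset.range r, (Nat.nth Nat.Prime i : ℝ) *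
        Real.log (Nat.nth Nat.Prime i) ^ 2 / ((Nat.nth Nat.Prime i : ℝ) - 1) ^ 2 +
      (c - Real.eulerMascheroniConstant ^ 2))| / 2 := by
  rw [gammaP_one_eq, (entirePartialZeta_jet hc r rfl rfl rfl).2.2, norm_neg, norm_div,
    Complex.norm_real, Real.norm_eq_abs, Complex.norm_ofNat]

/-- Multiplying in one further Euler factor increases the second Taylor coefficient. -/
theorem abs_mul_lt_abs_mul_of_bounds {A D U c w p : ℝ} (hA : 0 < A) (hp : 1 < p)
    (h0 : 0 < D ^ 2 - U + c) (h1 : D ^ 2 - U + c < w * (2 * D - w)) :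
    |A * (D ^ 2 - U + c)| <
      |A * (1 - 1 / p) * ((D + w / (p - 1)) ^ 2 - (U + p * w ^ 2 / (p - 1) ^ 2) + c)| := by
  have hp0 : 0 < p := by linarith
  have hp1 : p - 1 ≠ 0 := by linarith
  -- The `w²/(p - 1)²` terms cancel, so the increment is exact and has the sign of `h1`.
  have heq : A * (1 - 1 / p) * ((D + w / (p - 1)) ^ 2 - (U + p * w ^ 2 / (p - 1) ^ 2) + c) =
      A * (D ^ 2 - U + c) + A / p * (w * (2 * D - w) - (D ^ 2 - U + c)) := by
    field_simp
    ring
  rw [heq, abs_of_pos (by positivity)]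
  refine lt_of_lt_of_le ?_ (le_abs_self _)
  have : 0 < A / p * (w * (2 * D - w) - (D ^ 2 - U + c)) :=
    mul_pos (by positivity) (by linarith)
  linarith

theorem theorem5 : {r : ℕ | ¬ ‖gammaP 1 r‖ < ‖gammaP 1 (r + 1)‖}.Finite := by
  obtain ⟨c, hc⟩ := exists_deriv_deriv_riemannZeta₁_eq_ofReal
  obtain ⟨K, hK0, hK⟩ := exists_sum_mul_log_sq_div_bounds
  set g := Real.eulerMascheroniConstant with hg
  set K' := 1 + K + |g| + |c - g ^ 2| with hK'
  have hlarge : ∀ᶠ r : ℕ in Filter.atTop,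
      100 * K' ≤ Real.log ((Nat.nth Nat.Prime r - 1 : ℕ) : ℝ) := by
    have hnth : Filter.Tendsto (fun r ↦ Nat.nth Nat.Prime r - 1) Filter.atTop Filter.atTop :=
      (Filter.tendsto_sub_atTop_nat 1).comp
        (Nat.nth_strictMono Nat.infinite_setOfPred_prime).tendsto_atTop
    exact (Real.tendsto_log_atTop.comp (tendsto_natCast_atTop_atTop.comp hnth)).eventually_ge_atTop _
  rw [← Nat.cofinite_eq_atTop] at hlarge
  -- Exceptional `r` lie among the finitely many with `log (pᵣ - 1) < 100 K'`.
  refine Set.Finite.subset (Filter.eventually_cofinite.mp hlarge) fun r hr hl ↦ hr ?_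
  set p := Nat.nth Nat.Prime r with hp
  have hpp : p.Prime := Nat.prime_nth_prime r
  have hn : p - 1 ≠ 0 := (Nat.sub_pos_of_lt hpp.one_lt).ne'
  obtain ⟨hT, hU1, hU2⟩ := hK (p - 1) hn
  rw [norm_gammaP_one_eq hc, norm_gammaP_one_eq hc, Finset.prod_range_succ,
    Finset.sum_range_succ, Finset.sum_range_succ, ← hp, ← hg, ← add_assoc]
  rw [← sum_range_nth_prime (fun p ↦ Real.log p / ((p : ℝ) - 1))] at hT
  rw [← sum_range_nth_prime (fun p ↦ p * Real.log p ^ 2 / ((p : ℝ) - 1) ^ 2)] at hU1 hU2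
  set T := ∑ i ∈ Finset.range r,
    Real.log (Nat.nth Nat.Prime i) / ((Nat.nth Nat.Prime i : ℝ) - 1)
  set U := ∑ i ∈ Finset.range r, (Nat.nth Nat.Prime i : ℝ) *
    Real.log (Nat.nth Nat.Prime i) ^ 2 / ((Nat.nth Nat.Prime i : ℝ) - 1) ^ 2
  set l := Real.log ((p - 1 : ℕ) : ℝ) with hl_def
  have hl0 : 0 ≤ l := Real.log_natCast_nonneg _
  have hgn := abs_nonneg g
  have hcn := abs_nonneg (c - g ^ 2)
  have hKK' : K ≤ K' := by linarith
  have hn0 : (0 : ℝ) < (p - 1 : ℕ) := by exact_mod_cast Nat.pos_of_ne_zero hn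
  have hw1 : l ≤ Real.log p := Real.log_le_log hn0 (by exact_mod_cast Nat.sub_le p 1)
  -- The sums stop at `p - 1`; since `p ≤ 2 (p - 1)`, the shift costs at most `log 2`.
  have hw2 : Real.log p ≤ l + 1 := by
    have h : Real.log p ≤ Real.log (2 * (p - 1 : ℕ) : ℝ) :=
      Real.log_le_log (by exact_mod_cast hpp.pos) (by norm_cast; have := hpp.two_le; omega)
    rw [Real.log_mul two_ne_zero hn0.ne'] at h
    linarith [Real.log_two_lt_d9]
  have hD : |g + T - l| ≤ K' := by
    have := abs_add_le g (T - l)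
    rw [add_sub_assoc]
    linarith
  have hKl := mul_le_mul_of_nonneg_right hKK' hl0
  obtain ⟨h0, h1⟩ := pos_and_lt_of_log_bounds (c := c - g ^ 2) (by linarith : 1 ≤ K') hl hD
    (by linarith) (hU2.trans (by linarith)) hw1 hw2 (by linarith)
  have hA : 0 < ∏ i ∈ Finset.range r, (1 - 1 / (Nat.nth Nat.Prime i : ℝ)) :=
    Finset.prod_pos fun i _ ↦ by
      have : (1 : ℝ) < Nat.nth Nat.Prime i := by exact_mod_cast (Nat.prime_nth_prime i).one_lt
      rw [sub_pos, div_lt_one (by linarith)]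
      exact this
  have := abs_mul_lt_abs_mul_of_bounds hA
    (by exact_mod_cast hpp.one_lt : (1 : ℝ) < p) h0 h1
  linarith
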